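/- **Theorem.** Let $d\ge 0$, $n\ge 1$, $k\ge 0$ be integers and let $\Sigma\in\mathbb{R}^{d\times d}$ be symmetric positive definite. Let $x^{(1)},\dots,x^{(n+1)}\in\mathbb{R}^d$ be i.i.d. with law $\mathcal{N}(0,\Sigma)$ and let $w_\star\sim\mathcal{N}(0,\Sigma^{-1})$ be independent of them. Put $$Z_0=\begin{bmatrix}x^{(1)}&\cdots&x^{(n)}&x^{(n+1)}\\ \langle x^{(1)},w_\star\rangle&\cdots&\langle x^{(n)},w_\star\rangle&0\end{bmatrix}\in\mathbb{R}^{(d+1)\times(n+1)},\qquad M=\begin{bmatrix}I_n&0\\0&0\end{bmatrix}\in\mathbb{R}^{(n+1)\times(n+1)}.$$ For $A=(A_0,\dots,A_k)$ with $A_i\in\mathbb{R}^{d\times d}$, consider the linear transformer with the layers $i=0,\dots,k$, $$Z_{i+1}=Z_i+\tfrac1n\,P_iZ_iM\,(Z_i^\top Q_iZ_i),\qquad P_i=\begin{bmatrix}0_{d\times d}&0\\0&1\end{bmatrix},\quad Q_i=\begin{bmatrix}A_i&0\\0&0\end{bmatrix},$$ and the in-context loss $$f(A)=\mathbb{E}\Bigl[\bigl([Z_{k+1}]_{d+1,\,n+1}+w_\star^\top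 x^{(n+1)}\bigr)^2\Bigr].$$ Let $\mathcal{S}\subset\mathbb{R}^{(k+1)\times d\times d}$ be the set of those $A$ for which, for every $i\in\{0,\dots,k\}$, there is $a_i\in\mathbb{R}$ with $A_i=a_i\Sigma^{-1}$. Then the expectation defining $f(A)$ is finite for every $A\in\mathbb{R}^{(k+1)\times d\times d}$, $f$ is differentiable on $\mathbb{R}^{(k+1)\times d\times d}$, and $$\inf_{A\in\mathcal{S}}\ \sum_{i=0}^{k}\bigl\|\nabla_{A_i}f(A)\bigr\|_F^2=0,$$ where $\|\cdot\|_F$ is the Frobenius norm and $\nabla_{A_i}f(A)\in\mathbb{R}^{d\times d}$ is the gradient of $f$ in the matrix $A_i$ with respect to the Frobenius inner product (the matrix of the partial derivatives in the entries of $A_i$). -/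

import Mathlib

open MeasureTheory ProbabilityTheory

attribute [local instance] Matrix.frobeniusNormedAddCommGroup Matrix.frobeniusNormedSpace

namespace InContext

/-- Real `(d+1) × (d+1)` matrices, written in blocks of sizes `d` and `1`. -/
abbrev WeightMatrix (d : ℕ) : Type := Matrix (Fin d ⊕ Unit) (Fin d ⊕ Unit) ℝ

/-- Real `(d+1) × (n+1)` matrices: the columns are the `n` labelled tokens and the query token,
the last row holds the labels. -/
abbrev PromptMatrix (d n : ℕ) : Type := Matrix (Fin d ⊕ Unit) (Fin n ⊕ Unit) ℝ

/-- The mask `M = [[I_n, 0], [0, 0]]`. -/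
def mask (n : ℕ) : Matrix (Fin n ⊕ Unit) (Fin n ⊕ Unit) ℝ :=
  Matrix.fromBlocks 1 0 0 0

/-- Linear self-attention `Attn_{P,Q}(Z) = P Z M (Zᵀ Q Z)`. -/
def attn {d n : ℕ} (P Q : WeightMatrix d) (Z : PromptMatrix d n) : PromptMatrix d n :=
  P * Z * mask n * (Z.transpose * Q * Z)

/-- One layer with residual connection: `Z + (1/n) Attn_{P,Q}(Z)`. -/
noncomputable def layer {d n : ℕ} (P Q : WeightMatrix d) (Z : PromptMatrix d n) :
    PromptMatrix d n :=
  Z + (1 / (n : ℝ)) • attn P Q Z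

/-- The state `Z_L` after the layers `0, …, L - 1`, applied in this order to `Z_0 = Z`. -/
noncomputable def transformer {d n : ℕ} :
    (L : ℕ) → (P Q : Fin L → WeightMatrix d) → PromptMatrix d n → PromptMatrix d n
  | 0, _, _, Z => Z
  | L + 1, P, Q, Z =>
      layer (P (Fin.last L)) (Q (Fin.last L))
        (transformer L (fun i => P i.castSucc) (fun i => Q i.castSucc) Z)

/-- The input `Z_0`: columns `(x_j, ⟨x_j, w⟩)` for the `n` labelled tokens, and `(x_{n+1}, 0)` for
the query token `x_{n+1} = x (Fin.last n)`. -/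
noncomputable def prompt {d n : ℕ} (x : Fin (n + 1) → EuclideanSpace ℝ (Fin d))
    (w : EuclideanSpace ℝ (Fin d)) : PromptMatrix d n :=
  Matrix.fromBlocks
    (Matrix.of fun a j => x j.castSucc a) (Matrix.of fun a _ => x (Fin.last n) a)
    (Matrix.of fun _ j => inner ℝ (x j.castSucc) w) 0

/-- The squared prediction error on one prompt; the prediction of `⟨w, x_{n+1}⟩` is minus the
lower right corner of the output. -/
noncomputable def squaredError {d n L : ℕ} (P Q : Fin L → WeightMatrix d)
    (p : (Fin (n + 1) → EuclideanSpace ℝ (Fin d)) × EuclideanSpace ℝ (Fin d)) : ℝ :=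
  (transformer L P Q (prompt p.1 p.2) (Sum.inr ()) (Sum.inr ())
    + inner ℝ p.2 (p.1 (Fin.last n))) ^ 2

/-- The law of `((x_1, …, x_{n+1}), w)` with `x_i` i.i.d. `N(0, S)` and, independently of them,
`w ∼ N(0, S⁻¹)`. -/
noncomputable def promptLaw {d : ℕ} (n : ℕ) (S : Matrix (Fin d) (Fin d) ℝ) :
    Measure ((Fin (n + 1) → EuclideanSpace ℝ (Fin d)) × EuclideanSpace ℝ (Fin d)) :=
  (Measure.pi fun _ : Fin (n + 1) => multivariateGaussian 0 S).prod (multivariateGaussian 0 S⁻¹)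

/-- The sparse value matrix `P = [[0, 0], [0, 1]]`. -/
def sparseP (d : ℕ) : WeightMatrix d :=
  Matrix.fromBlocks 0 0 0 1

/-- The sparse key-query matrix `Q = [[A, 0], [0, 0]]`. -/
def sparseQ {d : ℕ} (A : Matrix (Fin d) (Fin d) ℝ) : WeightMatrix d :=
  Matrix.fromBlocks A 0 0 0

/-- The squared error on one prompt, under the sparse parametrization. -/
noncomputable def sparseSquaredError {d n L : ℕ} (A : Fin L → Matrix (Fin d) (Fin d) ℝ) :
    (Fin (n + 1) → EuclideanSpace ℝ (Fin d)) × EuclideanSpace ℝ (Fin d) → ℝ :=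
  squaredError (fun _ => sparseP d) (fun i => sparseQ (A i))

/-- The in-context loss `f(A)` under the sparse parametrization. -/
noncomputable def sparseLoss {d L : ℕ} (n : ℕ) (S : Matrix (Fin d) (Fin d) ℝ)
    (A : Fin L → Matrix (Fin d) (Fin d) ℝ) : ℝ :=
  ∫ p, sparseSquaredError A p ∂(promptLaw n S)

/-- The gradient of `g` at `A` with respect to the Frobenius inner product: the matrix of the
derivatives of `g` in the directions of the standard basis matrices, which are orthonormal. -/
noncomputable def frobeniusGradient {d : ℕ} (g : Matrix (Fin d) (Fin d) ℝ → ℝ)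
    (A : Matrix (Fin d) (Fin d) ℝ) : Matrix (Fin d) (Fin d) ℝ :=
  Matrix.of fun a b => fderiv ℝ g A (Matrix.single a b 1)

/-- `∇_{A_i} f(A)`: the gradient in the `i`-th matrix, the others being fixed. -/
noncomputable def layerGradient {d L : ℕ} (f : (Fin L → Matrix (Fin d) (Fin d) ℝ) → ℝ)
    (A : Fin L → Matrix (Fin d) (Fin d) ℝ) (i : Fin L) : Matrix (Fin d) (Fin d) ℝ :=
  frobeniusGradient (fun B => f (Function.update A i B)) (A i)

/-- The set of the parameters with every `A_i` a real multiple of `S⁻¹`. -/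
def invCovarianceSet {d : ℕ} (L : ℕ) (S : Matrix (Fin d) (Fin d) ℝ) :
    Set (Fin L → Matrix (Fin d) (Fin d) ℝ) :=
  {A | ∀ i, ∃ a : ℝ, A i = a • S⁻¹}

end InContext

/-! Write `S` for Σ, let g(a) be the loss at A_i = a_i S⁻¹, and let D be the derivative of the loss
in A_i at such a point. The substitution x ↦ Tx, w ↦ T⁻ᵀw with T S Tᵀ = S preserves the law of the
prompt and turns each A_i into Tᵀ A_i T, which fixes multiples of S⁻¹. Hence D(TᵀHT) = D(H). With S
= RRᵀ and T = R O R⁻¹, O orthogonal, D becomes after a change of variables a functional invariant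
under orthogonal conjugation, so a multiple of the trace
(`card_mul_eq_mul_trace_of_orthogonal_invariant`). For d > 0 the gradient in A_i is therefore D(S⁻¹)
d⁻¹ Sᵀ (`layerGradient_sparseLoss`), and D(S⁻¹) = ∂g/∂a_i. It remains to make ∇g small. No minimiser
of g is needed: since g ≥ 0, minimising g + δ|a|² with small δ suffices
(`exists_sum_sq_partialDeriv_le`). -/

namespace InContext

/-! ### Integrability and differentiability by separating parameters from randomness -/

/-- `F θ ω` is a finite sum of products of a differentiable function of the parameter `θ` and a
random variable all of whose moments are finite. -/
def SeparableMoments {V Ω : Type*} [NormedAddCommGroup V] [NormedSpace ℝ V] [MeasurableSpace Ω]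
    (μ : Measure Ω) (F : V → Ω → ℝ) : Prop :=
  ∃ (ι : Type) (_ : Fintype ι) (c : ι → V → ℝ) (h : ι → Ω → ℝ),
    (∀ i, Differentiable ℝ (c i)) ∧ (∀ i (q : ENNReal), q ≠ ⊤ → MemLp (h i) q μ) ∧
      ∀ θ ω, F θ ω = ∑ i, c i θ * h i ω

namespace SeparableMoments

variable {V Ω : Type*} [NormedAddCommGroup V] [NormedSpace ℝ V] [MeasurableSpace Ω]
  {μ : Measure Ω} {F G : V → Ω → ℝ}

theorem add (hF : SeparableMoments μ F) (hG : SeparableMoments μ G) :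
    SeparableMoments μ (fun θ ω => F θ ω + G θ ω) := by
  obtain ⟨ι, _, c, h, hc, hh, hF⟩ := hF
  obtain ⟨κ, _, c', h', hc', hh', hG⟩ := hG
  refine ⟨ι ⊕ κ, inferInstance, Sum.elim c c', Sum.elim h h', ?_, ?_, fun θ ω => ?_⟩
  · rintro (i | i)
    · exact hc i
    · exact hc' i
  · rintro (i | i)
    · exact hh i
    · exact hh' i
  · simp [hF, hG]

theorem mul (hF : SeparableMoments μ F) (hG : SeparableMoments μ G) :
    SeparableMoments μ (fun θ ω => F θ ω * G θ ω) := by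
  obtain ⟨ι, _, c, h, hc, hh, hF⟩ := hF
  obtain ⟨κ, _, c', h', hc', hh', hG⟩ := hG
  refine ⟨ι × κ, inferInstance, fun i θ => c i.1 θ * c' i.2 θ, fun i ω => h i.1 ω * h' i.2 ω,
    fun i => (hc i.1).mul (hc' i.2), fun i q hq => ?_, fun θ ω => ?_⟩
  -- Hölder: the q-norm of a product needs the 2q-norms of its factors. Requiring every finite
  -- exponent is what closes the class under products.
  · have : ENNReal.HolderTriple (2 * q) (2 * q) q := ⟨by
      rw [ENNReal.mul_inv (Or.inl two_ne_zero) (Or.inl ENNReal.ofNat_ne_top), ← add_mul,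
        ENNReal.inv_two_add_inv_two, one_mul]⟩
    have h2q : 2 * q ≠ ⊤ := ENNReal.mul_ne_top ENNReal.ofNat_ne_top hq
    exact (hh' i.2 _ h2q).mul' (hh i.1 _ h2q)
  · simp only [hF, hG]
    rw [Finset.sum_mul_sum, ← Finset.univ_product_univ, Finset.sum_product]
    refine Finset.sum_congr rfl fun i _ => Finset.sum_congr rfl fun j _ => ?_
    ring

theorem of_differentiable [IsFiniteMeasure μ] {c : V → ℝ} (hc : Differentiable ℝ c) :
    SeparableMoments μ (fun θ (_ : Ω) => c θ) :=
  ⟨Unit, inferInstance, fun _ => c, fun _ _ => 1, fun _ => hc, fun _ _ _ => memLp_const 1,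
    fun θ ω => by simp⟩

theorem const [IsFiniteMeasure μ] (a : ℝ) : SeparableMoments μ (fun (_ : V) (_ : Ω) => a) :=
  of_differentiable (differentiable_const a)

theorem of_memLp {h : Ω → ℝ} (hh : ∀ q : ENNReal, q ≠ ⊤ → MemLp h q μ) :
    SeparableMoments μ (fun (_ : V) ω => h ω) :=
  ⟨Unit, inferInstance, fun _ _ => 1, fun _ => h, fun _ => differentiable_const 1, fun _ => hh,
    fun θ ω => by simp⟩

theorem sum [IsFiniteMeasure μ] {κ : Type*} (s : Finset κ) {F : κ → V → Ω → ℝ}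
    (hF : ∀ i ∈ s, SeparableMoments μ (F i)) :
    SeparableMoments μ (fun θ ω => ∑ i ∈ s, F i θ ω) := by
  classical
  induction s using Finset.induction_on with
  | empty => simpa using const (0 : ℝ)
  | insert a s ha ih =>
    simp only [Finset.sum_insert ha]
    exact (hF a (Finset.mem_insert_self a s)).add
      (ih fun i hi => hF i (Finset.mem_insert_of_mem hi))

theorem integrable (hF : SeparableMoments μ F) (θ : V) : Integrable (F θ) μ := by
  obtain ⟨ι, _, c, h, hc, hh, hF⟩ := hF
  rw [show F θ = fun ω => ∑ i, c i θ * h i ω from funext (hF θ)]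
  exact integrable_finsetSum _ fun i _ =>
    (memLp_one_iff_integrable.1 (hh i 1 ENNReal.one_ne_top)).const_mul _

theorem differentiable_integral (hF : SeparableMoments μ F) :
    Differentiable ℝ (fun θ => ∫ ω, F θ ω ∂μ) := by
  obtain ⟨ι, _, c, h, hc, hh, hF⟩ := hF
  have : (fun θ => ∫ ω, F θ ω ∂μ) = fun θ => ∑ i, c i θ * ∫ ω, h i ω ∂μ := by
    funext θ
    simp_rw [hF]
    rw [integral_finsetSum]
    · simp_rw [integral_const_mul]
    · exact fun i _ => (memLp_one_iff_integrable.1 (hh i 1 ENNReal.one_ne_top)).const_mul _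
  rw [this]
  exact Differentiable.fun_sum fun i _ => (hc i).mul_const _

theorem matrix_mul [IsFiniteMeasure μ] {l m o : Type*} [Fintype m]
    {F : V → Ω → Matrix l m ℝ} {G : V → Ω → Matrix m o ℝ}
    (hF : ∀ a b, SeparableMoments μ (fun θ ω => F θ ω a b))
    (hG : ∀ a b, SeparableMoments μ (fun θ ω => G θ ω a b)) (a : l) (b : o) :
    SeparableMoments μ (fun θ ω => (F θ ω * G θ ω) a b) := by
  simp only [Matrix.mul_apply]
  exact sum _ fun i _ => (hF a i).mul (hG i b)

theorem layer [IsFiniteMeasure μ] {d n : ℕ} {P Q : V → WeightMatrix d}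
    {Z : V → Ω → PromptMatrix d n} (hP : ∀ a b, Differentiable ℝ (fun θ => P θ a b))
    (hQ : ∀ a b, Differentiable ℝ (fun θ => Q θ a b))
    (hZ : ∀ a b, SeparableMoments μ (fun θ ω => Z θ ω a b)) (a : Fin d ⊕ Unit)
    (b : Fin n ⊕ Unit) :
    SeparableMoments μ (fun θ ω => InContext.layer (P θ) (Q θ) (Z θ ω) a b) := by
  simp only [InContext.layer, attn, Matrix.add_apply, Matrix.smul_apply, smul_eq_mul]
  refine (hZ a b).add ((const _).mul ?_)
  refine matrix_mul (fun a b => ?_) (fun a b => ?_) a b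
  · exact matrix_mul (matrix_mul (fun a b => of_differentiable (hP a b)) hZ)
      (fun a b => const (mask n a b)) a b
  · exact matrix_mul (matrix_mul (fun a b => hZ b a) (fun a b => of_differentiable (hQ a b)))
      hZ a b

theorem transformer [IsFiniteMeasure μ] {d n : ℕ} {Z : Ω → PromptMatrix d n}
    (hZ : ∀ a b, ∀ q : ENNReal, q ≠ ⊤ → MemLp (fun ω => Z ω a b) q μ) (L : ℕ)
    {P Q : V → Fin L → WeightMatrix d} (hP : ∀ i a b, Differentiable ℝ (fun θ => P θ i a b))
    (hQ : ∀ i a b, Differentiable ℝ (fun θ => Q θ i a b)) (a : Fin d ⊕ Unit)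
    (b : Fin n ⊕ Unit) :
    SeparableMoments μ (fun θ ω => InContext.transformer L (P θ) (Q θ) (Z ω) a b) := by
  induction L generalizing a b with
  | zero => exact of_memLp (hZ a b)
  | succ L ih =>
    exact layer (hP _) (hQ _) (ih (fun i => hP i.castSucc) (fun i => hQ i.castSucc)) a b

end SeparableMoments

instance isProbabilityMeasure_promptLaw {d : ℕ} (n : ℕ) (S : Matrix (Fin d) (Fin d) ℝ) :
    IsProbabilityMeasure (promptLaw n S) := by
  unfold promptLaw; infer_instance

/-! ### Gaussian moments of the prompt entries -/

section Moments

variable {d n : ℕ} {S : Matrix (Fin d) (Fin d) ℝ}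

theorem memLp_coord_multivariateGaussian (S : Matrix (Fin d) (Fin d) ℝ) (a : Fin d)
    {q : ENNReal} (hq : q ≠ ⊤) :
    MemLp (fun x : EuclideanSpace ℝ (Fin d) => x a) q (multivariateGaussian 0 S) :=
  IsGaussian.memLp_dual _ (EuclideanSpace.proj a) q hq

theorem memLp_token (j : Fin (n + 1)) (a : Fin d) {q : ENNReal} (hq : q ≠ ⊤) :
    MemLp (fun p : (Fin (n + 1) → EuclideanSpace ℝ (Fin d)) × EuclideanSpace ℝ (Fin d) =>
      p.1 j a) q (promptLaw n S) :=
  (memLp_coord_multivariateGaussian S a hq).comp_measurePreserving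
    ((measurePreserving_eval (fun _ : Fin (n + 1) => multivariateGaussian 0 S) j).comp
      measurePreserving_fst)

theorem memLp_weight (a : Fin d) {q : ENNReal} (hq : q ≠ ⊤) :
    MemLp (fun p : (Fin (n + 1) → EuclideanSpace ℝ (Fin d)) × EuclideanSpace ℝ (Fin d) =>
      p.2 a) q (promptLaw n S) :=
  (memLp_coord_multivariateGaussian S⁻¹ a hq).comp_measurePreserving measurePreserving_snd

theorem memLp_label (j : Fin (n + 1)) {q : ENNReal} (hq : q ≠ ⊤) :
    MemLp (fun p : (Fin (n + 1) → EuclideanSpace ℝ (Fin d)) × EuclideanSpace ℝ (Fin d) =>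
      (inner ℝ (p.1 j) p.2 : ℝ)) q (promptLaw n S) := by
  simp only [PiLp.inner_apply, RCLike.inner_apply, conj_trivial]
  refine memLp_finsetSum _ fun a _ => ?_
  have : ENNReal.HolderTriple (2 * q) (2 * q) q := ⟨by
    rw [ENNReal.mul_inv (Or.inl two_ne_zero) (Or.inl ENNReal.ofNat_ne_top), ← add_mul,
      ENNReal.inv_two_add_inv_two, one_mul]⟩
  have h2q : 2 * q ≠ ⊤ := ENNReal.mul_ne_top ENNReal.ofNat_ne_top hq
  exact (memLp_token j a h2q).mul' (memLp_weight a h2q)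

theorem memLp_prompt (a : Fin d ⊕ Unit) (b : Fin n ⊕ Unit) {q : ENNReal} (hq : q ≠ ⊤) :
    MemLp (fun p : (Fin (n + 1) → EuclideanSpace ℝ (Fin d)) × EuclideanSpace ℝ (Fin d) =>
      prompt p.1 p.2 a b) q (promptLaw n S) := by
  rcases a with a | a <;> rcases b with b | b
  · exact memLp_token b.castSucc a hq
  · exact memLp_token (Fin.last n) a hq
  · exact memLp_label b.castSucc hq
  · exact memLp_const (0 : ℝ)

theorem differentiable_sparseQ_apply {L : ℕ} (i : Fin L) (a b : Fin d ⊕ Unit) :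
    Differentiable ℝ (fun A : Fin L → Matrix (Fin d) (Fin d) ℝ => sparseQ (A i) a b) := by
  rcases a with a | a <;> rcases b with b | b
  · exact (LinearMap.toContinuousLinearMap ((Matrix.entryLinearMap ℝ ℝ a b).comp
      (LinearMap.proj (R := ℝ) (φ := fun _ : Fin L => Matrix (Fin d) (Fin d) ℝ) i))).differentiable
  all_goals exact differentiable_const 0

theorem separableMoments_sparseSquaredError (L : ℕ) :
    SeparableMoments (promptLaw n S)
      (fun A : Fin L → Matrix (Fin d) (Fin d) ℝ => sparseSquaredError (n := n) A) := by
  have h : SeparableMoments (promptLaw n S)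
      (fun (A : Fin L → Matrix (Fin d) (Fin d) ℝ) p =>
        transformer L (fun _ => sparseP d) (fun i => sparseQ (A i)) (prompt p.1 p.2)
          (Sum.inr ()) (Sum.inr ()) + inner ℝ p.2 (p.1 (Fin.last n))) := by
    refine (SeparableMoments.transformer (V := Fin L → Matrix (Fin d) (Fin d) ℝ)
      (P := fun _ _ => sparseP d) (Q := fun A i => sparseQ (A i))
      (fun a b q hq => memLp_prompt a b hq) L (fun _ _ _ => differentiable_const _)
      (fun i a b => differentiable_sparseQ_apply i a b) (Sum.inr ()) (Sum.inr ())).add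
      (SeparableMoments.of_memLp fun q hq => ?_)
    convert memLp_label (Fin.last n) hq using 2 with p
    exact real_inner_comm _ _
  have h2 := h.mul h
  simp only [← sq] at h2
  exact h2

end Moments

open Matrix

/-! ### Linear symmetries of the prompt law and of the loss -/

section Invariance

variable {d n : ℕ} {S T U : Matrix (Fin d) (Fin d) ℝ}

theorem inner_toEuclideanCLM_left (T : Matrix (Fin d) (Fin d) ℝ)
    (x y : EuclideanSpace ℝ (Fin d)) :
    inner ℝ (toEuclideanCLM (𝕜 := ℝ) T x) y = inner ℝ x (toEuclideanCLM (𝕜 := ℝ) Tᵀ y) := by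
  simp only [EuclideanSpace.inner_eq_star_dotProduct, ofLp_toEuclideanCLM, star_trivial]
  rw [dotProduct_mulVec, mulVec_transpose]

theorem measurePreserving_toEuclideanCLM_multivariateGaussian (hS : S.PosSemidef)
    (hT : T * S * Tᵀ = S) :
    MeasurePreserving (toEuclideanCLM (𝕜 := ℝ) T) (multivariateGaussian 0 S)
      (multivariateGaussian 0 S) := by
  refine ⟨by fun_prop, Measure.ext_of_charFun (funext fun t => ?_)⟩
  rw [charFun_apply, integral_map (by fun_prop) (by fun_prop)]
  simp_rw [inner_toEuclideanCLM_left]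
  rw [← charFun_apply, charFun_multivariateGaussian hS, charFun_multivariateGaussian hS]
  have h : (Tᵀ *ᵥ t.ofLp) ⬝ᵥ S *ᵥ (Tᵀ *ᵥ t.ofLp) = t.ofLp ⬝ᵥ S *ᵥ t.ofLp := by
    nth_rw 1 [mulVec_transpose]
    rw [← dotProduct_mulVec, mulVec_mulVec, mulVec_mulVec, hT]
  simp only [ofLp_toEuclideanCLM, inner_zero_right, h]

/-- Here `U` stands for T⁻ᵀ; the identity makes it preserve N(0, S⁻¹), the law of w. -/
theorem mul_inv_mul_transpose_eq_inv (hT : T * S * Tᵀ = S) (hU : Tᵀ * U = 1) :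
    U * S⁻¹ * Uᵀ = S⁻¹ := by
  have h := congrArg (·⁻¹) hT
  have hU' : Uᵀ * T = 1 := by rw [← transpose_inj]; simpa using hU
  simpa [Matrix.mul_inv_rev, inv_eq_right_inv hU, inv_eq_left_inv hU', Matrix.mul_assoc] using h

theorem transpose_mul_inv_mul_eq_inv (hT : T * S * Tᵀ = S) (hU : Tᵀ * U = 1) :
    Tᵀ * S⁻¹ * T = S⁻¹ := by
  have hU' : Uᵀ * T = 1 := by rw [← transpose_inj]; simpa using hU
  calc Tᵀ * S⁻¹ * T = Tᵀ * (U * S⁻¹ * Uᵀ) * T := by rw [mul_inv_mul_transpose_eq_inv hT hU]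
    _ = (Tᵀ * U) * S⁻¹ * (Uᵀ * T) := by simp only [Matrix.mul_assoc]
    _ = S⁻¹ := by rw [hU, hU', Matrix.one_mul, Matrix.mul_one]

theorem prompt_toEuclideanCLM (hU : Tᵀ * U = 1) (x : Fin (n + 1) → EuclideanSpace ℝ (Fin d))
    (w : EuclideanSpace ℝ (Fin d)) :
    prompt (fun j => toEuclideanCLM (𝕜 := ℝ) T (x j)) (toEuclideanCLM (𝕜 := ℝ) U w) =
      (fromBlocks T 0 0 1 : WeightMatrix d) * prompt x w := by
  have h (y : EuclideanSpace ℝ (Fin d)) :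
      inner ℝ (toEuclideanCLM (𝕜 := ℝ) T y) (toEuclideanCLM (𝕜 := ℝ) U w) = inner ℝ y w := by
    rw [inner_toEuclideanCLM_left, ← mul_apply_eq_comp, ← map_mul, hU, map_one,
      one_apply_eq_self]
  simp only [prompt, fromBlocks_multiply, h]
  congr 1 <;> ext a b <;> simp [Matrix.mul_apply, mulVec, dotProduct]

/-- The block matrix diag(T, 1) commutes with `sparseP d`, while inside Zᵀ Q Z it acts on Q by
congruence. -/
theorem attn_fromBlocks_mul (A : Matrix (Fin d) (Fin d) ℝ) (Z : PromptMatrix d n) :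
    attn (sparseP d) (sparseQ A) ((fromBlocks T 0 0 1 : WeightMatrix d) * Z) =
      (fromBlocks T 0 0 1 : WeightMatrix d) * attn (sparseP d) (sparseQ (Tᵀ * A * T)) Z := by
  have hP : sparseP d * fromBlocks T 0 0 1 = fromBlocks T 0 0 1 * sparseP d := by
    simp [sparseP, fromBlocks_multiply]
  have hQ : (sparseQ (Tᵀ * A * T) : WeightMatrix d) =
      (fromBlocks T 0 0 1)ᵀ * sparseQ A * fromBlocks T 0 0 1 := by
    simp [sparseQ, fromBlocks_multiply, fromBlocks_transpose]
  simp only [attn]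
  rw [hQ, ← Matrix.mul_assoc (sparseP d), hP]
  simp only [transpose_mul, Matrix.mul_assoc]

theorem transformer_fromBlocks_mul (L : ℕ) (A : Fin L → Matrix (Fin d) (Fin d) ℝ)
    (Z : PromptMatrix d n) :
    transformer L (fun _ => sparseP d) (fun i => sparseQ (A i))
        ((fromBlocks T 0 0 1 : WeightMatrix d) * Z) =
      (fromBlocks T 0 0 1 : WeightMatrix d) *
        transformer L (fun _ => sparseP d) (fun i => sparseQ (Tᵀ * A i * T)) Z := by
  induction L with
  | zero => rfl
  | succ L ih =>
    simp only [transformer]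
    rw [ih (fun i => A i.castSucc)]
    simp only [layer, attn_fromBlocks_mul, Matrix.mul_add, Matrix.mul_smul]

/-- Labels and the target ⟨w, x⟩ do not change because Tᵀ U = 1, and diag(T, 1) leaves the last row
of the output alone. -/
theorem sparseSquaredError_toEuclideanCLM {L : ℕ} (hU : Tᵀ * U = 1)
    (A : Fin L → Matrix (Fin d) (Fin d) ℝ)
    (p : (Fin (n + 1) → EuclideanSpace ℝ (Fin d)) × EuclideanSpace ℝ (Fin d)) :
    sparseSquaredError A
        ((fun j => toEuclideanCLM (𝕜 := ℝ) T (p.1 j)), toEuclideanCLM (𝕜 := ℝ) U p.2) =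
      sparseSquaredError (fun i => Tᵀ * A i * T) p := by
  have h : inner ℝ (toEuclideanCLM (𝕜 := ℝ) U p.2)
      (toEuclideanCLM (𝕜 := ℝ) T (p.1 (Fin.last n))) = inner ℝ p.2 (p.1 (Fin.last n)) := by
    rw [real_inner_comm, inner_toEuclideanCLM_left, ← mul_apply_eq_comp, ← map_mul,
      hU, map_one, one_apply_eq_self, real_inner_comm]
  simp only [sparseSquaredError, squaredError, prompt_toEuclideanCLM hU,
    transformer_fromBlocks_mul, h]
  congr 2
  simp [Matrix.mul_apply, Fintype.sum_sum_type]

theorem measurePreserving_promptLaw (hS : S.PosSemidef) (hT : T * S * Tᵀ = S)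
    (hU : Tᵀ * U = 1) :
    MeasurePreserving (fun p : (Fin (n + 1) → EuclideanSpace ℝ (Fin d)) ×
        EuclideanSpace ℝ (Fin d) =>
      ((fun j => toEuclideanCLM (𝕜 := ℝ) T (p.1 j)), toEuclideanCLM (𝕜 := ℝ) U p.2))
      (promptLaw n S) (promptLaw n S) :=
  (measurePreserving_pi _ _ fun _ : Fin (n + 1) =>
    measurePreserving_toEuclideanCLM_multivariateGaussian hS hT).prod
    (measurePreserving_toEuclideanCLM_multivariateGaussian hS.inv
      (mul_inv_mul_transpose_eq_inv hT hU))

theorem sparseLoss_transpose_mul_mul {L : ℕ} (hS : S.PosSemidef) (hT : T * S * Tᵀ = S)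
    (hU : Tᵀ * U = 1) (A : Fin L → Matrix (Fin d) (Fin d) ℝ) :
    sparseLoss n S (fun i => Tᵀ * A i * T) = sparseLoss n S A := by
  have hmp := measurePreserving_promptLaw (n := n) hS hT hU
  have hint := (separableMoments_sparseSquaredError (n := n) (S := S) L).integrable A
  have h := integral_map hmp.measurable.aemeasurable
    (by rw [hmp.map_eq]; exact hint.aestronglyMeasurable : AEStronglyMeasurable
      (sparseSquaredError (n := n) A) _)
  rw [hmp.map_eq] at h
  simp only [sparseLoss, h, sparseSquaredError_toEuclideanCLM hU]

end Invariance

/-! ### The gradient at multiples of the inverse covariance -/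

section Gradient

variable {d n : ℕ} {S : Matrix (Fin d) (Fin d) ℝ}

/-- A linear functional on matrices that is invariant under orthogonal conjugation is a multiple
of the trace. -/
theorem card_mul_eq_mul_trace_of_orthogonal_invariant (φ : Matrix (Fin d) (Fin d) ℝ →ₗ[ℝ] ℝ)
    (hφ : ∀ O E : Matrix (Fin d) (Fin d) ℝ, Oᵀ * O = 1 → φ (Oᵀ * E * O) = φ E)
    (E : Matrix (Fin d) (Fin d) ℝ) : d * φ E = φ 1 * E.trace := by
  have hoff (a b : Fin d) (hab : a ≠ b) : φ (single a b 1) = 0 := by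
    -- Flipping the sign of one coordinate negates this off-diagonal unit, so `φ` vanishes on it.
    have h := hφ (diagonal (Function.update 1 a (-1))) (single a b 1) (by
      rw [diagonal_transpose, diagonal_mul_diagonal, ← diagonal_one]
      congr 1
      funext j
      by_cases hj : j = a <;> simp [hj])
    have h2 : (diagonal (Function.update 1 a (-1)))ᵀ * single a b (1 : ℝ) *
        diagonal (Function.update 1 a (-1)) = - single a b 1 := by
      ext i j
      rw [diagonal_transpose, mul_diagonal, diagonal_mul, neg_apply, single_apply]
      by_cases h : a = i ∧ b = j
      · obtain ⟨rfl, rfl⟩ := h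
        simp [hab.symm]
      · simp [h]
    rw [h2, map_neg] at h
    linarith
  have hdiag (a b : Fin d) : φ (single a a 1) = φ (single b b 1) := by
    have h := hφ ((Equiv.swap a b).permMatrix ℝ) (single a a 1) (by
      rw [transpose_permMatrix, ← permMatrix_mul, mul_inv_cancel, permMatrix_one])
    rw [← h]
    congr 1
    rw [transpose_permMatrix, Equiv.swap_inv, Equiv.Perm.permMatrix,
      PEquiv.toMatrix_toPEquiv_mul, PEquiv.mul_toMatrix_toPEquiv, submatrix_submatrix,
      Function.comp_id, Function.id_comp, submatrix_single_equiv]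
    simp
  have hE (E : Matrix (Fin d) (Fin d) ℝ) (c : Fin d) : φ E = E.trace * φ (single c c 1) := by
    conv_lhs => rw [matrix_eq_sum_single E]
    simp only [map_sum]
    rw [trace, Finset.sum_mul]
    refine Finset.sum_congr rfl fun a _ => ?_
    rw [Finset.sum_eq_single a]
    · rw [← hdiag a c, diag_apply, ← smul_eq_mul, ← map_smul, smul_single, smul_eq_mul, mul_one]
    · intro b _ hb
      rw [← mul_one (E a b), ← smul_eq_mul, ← smul_single, map_smul, hoff a b hb.symm, smul_zero]
    · simp
  rcases Nat.eq_zero_or_pos d with rfl | hd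
  · simp
  · rw [hE E ⟨0, hd⟩, hE 1 ⟨0, hd⟩, trace_one, Fintype.card_fin]
    ring

open scoped MatrixOrder in
theorem exists_mul_transpose_eq (hS : S.PosDef) :
    ∃ R W : Matrix (Fin d) (Fin d) ℝ, R * Rᵀ = S ∧ W * R = 1 ∧ R * W = 1 := by
  have hR : CFC.sqrt S * CFC.sqrt S = S := CFC.sqrt_mul_sqrt_self S hS.posSemidef.nonneg
  have hRt : (CFC.sqrt S)ᵀ = CFC.sqrt S := by
    rw [← conjTranspose_eq_transpose_of_trivial]
    exact (CFC.sqrt_nonneg S).isSelfAdjoint.star_eq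
  have hu : IsUnit (CFC.sqrt S).det :=
    isUnit_of_mul_isUnit_left (by rw [← det_mul, hR]; exact hS.det_pos.ne'.isUnit)
  exact ⟨CFC.sqrt S, (CFC.sqrt S)⁻¹, by rw [hRt, hR], nonsing_inv_mul _ hu, mul_nonsing_inv _ hu⟩

/-- Chain rule for B ↦ TᵀBT, which preserves the loss and fixes every A_j, so that both derivatives
are taken at the same point. -/
theorem fderiv_update_transpose_mul_mul {L : ℕ} {T U : Matrix (Fin d) (Fin d) ℝ}
    (hS : S.PosSemidef) (hT : T * S * Tᵀ = S) (hU : Tᵀ * U = 1)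
    {A : Fin L → Matrix (Fin d) (Fin d) ℝ} (hA : A ∈ invCovarianceSet L S) (i : Fin L)
    (H : Matrix (Fin d) (Fin d) ℝ) :
    fderiv ℝ (fun B => sparseLoss n S (Function.update A i B)) (A i) (Tᵀ * H * T) =
      fderiv ℝ (fun B => sparseLoss n S (Function.update A i B)) (A i) H := by
  have hAT (j : Fin L) : Tᵀ * A j * T = A j := by
    obtain ⟨a, ha⟩ := hA j
    rw [ha, Matrix.mul_smul, Matrix.smul_mul, transpose_mul_inv_mul_eq_inv hT hU]
  let Φ : Matrix (Fin d) (Fin d) ℝ →L[ℝ] Matrix (Fin d) (Fin d) ℝ :=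
    LinearMap.toContinuousLinearMap
      { toFun := fun B => Tᵀ * B * T
        map_add' := fun B C => by rw [Matrix.mul_add, Matrix.add_mul]
        map_smul' := fun c B => by rw [Matrix.mul_smul, Matrix.smul_mul]; rfl }
  have hΦ (B : Matrix (Fin d) (Fin d) ℝ) : Φ B = Tᵀ * B * T := rfl
  set g : Matrix (Fin d) (Fin d) ℝ → ℝ := fun B => sparseLoss n S (Function.update A i B) with hg
  have hgd : Differentiable ℝ g :=
    (separableMoments_sparseSquaredError (n := n) (S := S) L).differentiable_integral.comp
      (fun B => (hasFDerivAt_update A B).differentiableAt)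
  have hgΦ : g ∘ Φ = g := by
    funext B
    simp only [hg, Function.comp_apply, hΦ]
    rw [← sparseLoss_transpose_mul_mul hS hT hU (Function.update A i B)]
    congr 1
    funext j
    by_cases hj : j = i
    · subst hj; simp
    · simp [hj, hAT]
  have h := ((hgd (Φ (A i))).hasFDerivAt.comp (A i) Φ.hasFDerivAt).fderiv
  rw [hgΦ, hΦ (A i), hAT] at h
  exact (DFunLike.congr_fun h H).symm

/-- Conjugating by a root `R` of S reduces to the trace lemma; keeping d as a factor avoids dividing
by zero when d = 0. -/
theorem card_mul_fderiv_update {L : ℕ} (hS : S.PosDef)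
    {A : Fin L → Matrix (Fin d) (Fin d) ℝ} (hA : A ∈ invCovarianceSet L S) (i : Fin L)
    (H : Matrix (Fin d) (Fin d) ℝ) :
    d * fderiv ℝ (fun B => sparseLoss n S (Function.update A i B)) (A i) H =
      fderiv ℝ (fun B => sparseLoss n S (Function.update A i B)) (A i) S⁻¹ *
        (S * H).trace := by
  obtain ⟨R, W, hRS, hWR, hRW⟩ := exists_mul_transpose_eq hS
  have hWR' : Rᵀ * Wᵀ = 1 := by rw [← transpose_mul, hWR, transpose_one]
  have hRW' : Wᵀ * Rᵀ = 1 := by rw [← transpose_mul, hRW, transpose_one]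
  set D := fderiv ℝ (fun B => sparseLoss n S (Function.update A i B)) (A i) with hD
  let φ : Matrix (Fin d) (Fin d) ℝ →ₗ[ℝ] ℝ :=
    { toFun := fun E => D (Wᵀ * E * W)
      map_add' := fun B C => by rw [Matrix.mul_add, Matrix.add_mul, map_add]
      map_smul' := fun c B => by rw [Matrix.mul_smul, Matrix.smul_mul, map_smul]; rfl }
  have hφ (E : Matrix (Fin d) (Fin d) ℝ) : φ E = D (Wᵀ * E * W) := rfl
  have h := card_mul_eq_mul_trace_of_orthogonal_invariant φ (fun O E hO => ?_) (Rᵀ * H * R)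
  · have h1 : Wᵀ * (Rᵀ * H * R) * W = H := by
      calc _ = (Wᵀ * Rᵀ) * H * (R * W) := by simp only [Matrix.mul_assoc]
        _ = H := by rw [hRW', hRW, Matrix.one_mul, Matrix.mul_one]
    have h2 : Wᵀ * 1 * W = S⁻¹ := by
      rw [Matrix.mul_one]
      refine (inv_eq_left_inv ?_).symm
      calc _ = Wᵀ * ((W * R) * Rᵀ) := by rw [← hRS]; simp only [Matrix.mul_assoc]
        _ = 1 := by rw [hWR, Matrix.one_mul, hRW']
    rw [hφ, hφ, h1, h2, Matrix.mul_assoc, trace_mul_comm, Matrix.mul_assoc, trace_mul_comm, hRS]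
      at h
    exact h
  -- The symmetry is T = R O R⁻¹, with T⁻ᵀ = Wᵀ O Rᵀ.
  · have hO' : O * Oᵀ = 1 := mul_eq_one_comm.1 hO
    have hT : (R * O * W) * S * (R * O * W)ᵀ = S := by
      calc _ = R * O * (W * R) * (Rᵀ * Wᵀ) * Oᵀ * Rᵀ := by
            rw [← hRS]; simp only [transpose_mul, Matrix.mul_assoc]
        _ = R * (O * Oᵀ) * Rᵀ := by
            rw [hWR, hWR', Matrix.mul_one, Matrix.mul_one]; simp only [Matrix.mul_assoc]
        _ = S := by rw [hO', Matrix.mul_one, hRS]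
    have hU : (R * O * W)ᵀ * (Wᵀ * O * Rᵀ) = 1 := by
      calc _ = Wᵀ * (Oᵀ * ((Rᵀ * Wᵀ) * O)) * Rᵀ := by
            simp only [transpose_mul, Matrix.mul_assoc]
        _ = 1 := by rw [hWR', Matrix.one_mul, hO, Matrix.mul_one, hRW']
    have h := fderiv_update_transpose_mul_mul (n := n) hS.posSemidef hT hU hA i (Wᵀ * E * W)
    rw [← hD] at h
    rw [hφ, hφ, ← h]
    congr 1
    calc _ = Wᵀ * Oᵀ * E * O * W := by simp only [Matrix.mul_assoc]
      _ = Wᵀ * Oᵀ * (Rᵀ * Wᵀ) * E * (W * R) * O * W := by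
          rw [hWR, hWR', Matrix.mul_one, Matrix.mul_one]
      _ = _ := by simp only [transpose_mul, Matrix.mul_assoc]

theorem layerGradient_sparseLoss {L : ℕ} (hS : S.PosDef)
    {A : Fin L → Matrix (Fin d) (Fin d) ℝ} (hA : A ∈ invCovarianceSet L S) (i : Fin L) :
    layerGradient (sparseLoss n S) A i =
      fderiv ℝ (fun B => sparseLoss n S (Function.update A i B)) (A i) S⁻¹ •
        ((d : ℝ)⁻¹ • Sᵀ) := by
  ext a b
  -- The entry index `a` rules out d = 0.
  have hd : (d : ℝ) ≠ 0 := Nat.cast_ne_zero.2 (Fin.pos a).ne'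
  have h := card_mul_fderiv_update (n := n) hS hA i (single a b 1)
  rw [trace_mul_single] at h
  simp only [layerGradient, frobeniusGradient, of_apply, Matrix.smul_apply, transpose_apply, smul_eq_mul]
  field_simp
  rw [mul_comm]
  simpa using h

/-- Identifies D(S⁻¹) with the partial derivative of g, taking C = S⁻¹. -/
theorem hasDerivAt_update_smul {L : ℕ} {f : (Fin L → Matrix (Fin d) (Fin d) ℝ) → ℝ}
    (hf : Differentiable ℝ f) (C : Matrix (Fin d) (Fin d) ℝ) (a : Fin L → ℝ) (i : Fin L) :
    HasDerivAt (fun t => f (fun j => Function.update a i t j • C))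
      (fderiv ℝ (fun B => f (Function.update (fun j => a j • C) i B)) (a i • C) C) (a i) := by
  have hd : DifferentiableAt ℝ (fun B => f (Function.update (fun j => a j • C) i B)) (a i • C) :=
    (hf _).comp _ (hasFDerivAt_update _ _).differentiableAt
  have h := hd.hasFDerivAt.comp_hasDerivAt (a i) ((hasDerivAt_id (a i)).smul_const C)
  rw [one_smul] at h
  have hcomp : (fun t => f (fun j => Function.update a i t j • C)) =
      (fun B => f (Function.update (fun j => a j • C) i B)) ∘ fun t => id t • C := by
    funext t
    simp only [Function.comp_apply, id_eq]
    congr 1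
    funext j
    by_cases hj : j = i
    · subst hj; simp
    · simp [hj]
  rw [hcomp]
  exact h

end Gradient

/-! ### Almost critical points of a nonnegative function -/

/-- A nonnegative function on `ℝᵐ` with partial derivatives has points with arbitrarily small
gradient. -/
theorem exists_sum_sq_partialDeriv_le {m : ℕ} {g : (Fin m → ℝ) → ℝ} (hg : Continuous g)
    (h0 : ∀ a, 0 ≤ g a) {g' : (Fin m → ℝ) → Fin m → ℝ}
    (hg' : ∀ a i, HasDerivAt (fun t => g (Function.update a i t)) (g' a i) (a i)) {ε : ℝ}
    (hε : 0 < ε) : ∃ a, ∑ i, g' a i ^ 2 ≤ ε := by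
  obtain ⟨δ, hδ, hδε⟩ : ∃ δ : ℝ, 0 < δ ∧ 4 * δ * g 0 ≤ ε := by
    refine ⟨ε / (4 * (g 0 + 1)), by have := h0 0; positivity, ?_⟩
    have := h0 0
    rw [show 4 * (ε / (4 * (g 0 + 1))) * g 0 = ε * (g 0 / (g 0 + 1)) by field_simp]
    exact mul_le_of_le_one_right hε.le ((div_le_one (by positivity)).2 (by linarith))
  obtain ⟨a, ha⟩ : ∃ a, ∀ b, g a + δ * ∑ j, a j ^ 2 ≤ g b + δ * ∑ j, b j ^ 2 := by
    refine Continuous.exists_forall_le' (f := fun b => g b + δ * ∑ j, b j ^ 2) (by fun_prop) 0 ?_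
    -- The summand 1 forces ‖b‖ ≥ 1, hence ‖b‖² ≥ ‖b‖ ≥ g(0)/δ, and the penalty alone exceeds the
    -- value at 0.
    filter_upwards [(tendsto_norm_cocompact_atTop (E := Fin m → ℝ)).eventually_ge_atTop
      (1 + g 0 / δ)] with b hb
    have h1 : 0 ≤ g 0 / δ := div_nonneg (h0 0) hδ.le
    have h2 : ‖b‖ ^ 2 ≤ ∑ j, b j ^ 2 := by
      have h3 : ‖b‖ ≤ √(∑ j, b j ^ 2) := (pi_norm_le_iff_of_nonneg (Real.sqrt_nonneg _)).2
        fun j => Real.abs_le_sqrt (Finset.single_le_sum (f := fun j => b j ^ 2)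
          (fun j _ => sq_nonneg _) (Finset.mem_univ j))
      exact (Real.le_sqrt (norm_nonneg _) (Finset.sum_nonneg fun j _ => sq_nonneg _)).1 h3
    have h4 : g 0 / δ ≤ ∑ j, b j ^ 2 := by nlinarith
    have h5 := (div_le_iff₀' hδ).1 h4
    simpa using h5.trans (le_add_of_nonneg_left (h0 b))
  have hderiv (i : Fin m) : g' a i = -(2 * δ * a i) := by
    have hmin : IsLocalMin (fun t => g (Function.update a i t) + δ * t ^ 2) (a i) := by
      refine Filter.Eventually.of_forall fun t => ?_
      have h := ha (Function.update a i t)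
      have hsum (b : Fin m → ℝ) : ∑ j, b j ^ 2 = b i ^ 2 + ∑ j ∈ Finset.univ.erase i, b j ^ 2 :=
        (Finset.add_sum_erase _ _ (Finset.mem_univ i)).symm
      have hrest : ∑ j ∈ Finset.univ.erase i, Function.update a i t j ^ 2 =
          ∑ j ∈ Finset.univ.erase i, a j ^ 2 :=
        Finset.sum_congr rfl fun j hj => by
          rw [Function.update_of_ne (Finset.ne_of_mem_erase hj)]
      rw [hsum a, hsum (Function.update a i t), hrest, Function.update_self] at h
      simp only [Function.update_eq_self]
      linarith
    have h := hmin.hasDerivAt_eq_zero ((hg' a i).add ((hasDerivAt_pow 2 (a i)).const_mul δ))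
    norm_num at h
    linarith
  refine ⟨a, ?_⟩
  -- Comparing with 0 gives δ|a|² ≤ g(0), so |∇g(a)|² = 4δ²|a|² ≤ 4δ g(0).
  have h := ha 0
  simp only [Pi.zero_apply, ne_eq, OfNat.ofNat_ne_zero, not_false_eq_true, zero_pow,
    Finset.sum_const_zero, mul_zero, add_zero] at h
  calc ∑ i, g' a i ^ 2 = 4 * δ * (δ * ∑ i, a i ^ 2) := by
        simp only [hderiv, Finset.mul_sum]
        exact Finset.sum_congr rfl fun i _ => by ring
    _ ≤ 4 * δ * g 0 := by
        have := h0 a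
        gcongr
        linarith
    _ ≤ ε := hδε

end InContext

/-! ### Assembly -/

theorem mainTheorem4 (d n k : ℕ) (hn : 1 ≤ n) (S : Matrix (Fin d) (Fin d) ℝ) (hS : S.PosDef) :
    (∀ A : Fin (k + 1) → Matrix (Fin d) (Fin d) ℝ,
      Integrable (InContext.sparseSquaredError (n := n) A) (InContext.promptLaw n S)) ∧
    Differentiable ℝ
      (fun A : Fin (k + 1) → Matrix (Fin d) (Fin d) ℝ => InContext.sparseLoss n S A) ∧
    IsGLB
      ((fun A : Fin (k + 1) → Matrix (Fin d) (Fin d) ℝ =>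
          ∑ i, ‖InContext.layerGradient (InContext.sparseLoss n S) A i‖ ^ 2) ''
        InContext.invCovarianceSet (k + 1) S) 0 := by
  have hsep := InContext.separableMoments_sparseSquaredError (n := n) (S := S) (k + 1)
  have hdiff : Differentiable ℝ
      (fun A : Fin (k + 1) → Matrix (Fin d) (Fin d) ℝ => InContext.sparseLoss n S A) :=
    hsep.differentiable_integral
  refine ⟨hsep.integrable, hdiff, ?_, fun b hb => ?_⟩
  · rintro _ ⟨A, -, rfl⟩
    positivity
  · let A (a : Fin (k + 1) → ℝ) : Fin (k + 1) → Matrix (Fin d) (Fin d) ℝ := fun j => a j • S⁻¹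
    have hA (a : Fin (k + 1) → ℝ) : A a ∈ InContext.invCovarianceSet (k + 1) S :=
      fun j => ⟨a j, rfl⟩
    set K : ℝ := ‖(d : ℝ)⁻¹ • S.transpose‖ ^ 2 with hK
    refine le_of_forall_pos_le_add fun ε hε => ?_
    obtain ⟨a, ha⟩ := InContext.exists_sum_sq_partialDeriv_le
      (g := fun a => InContext.sparseLoss n S (A a)) (hdiff.continuous.comp (by fun_prop))
      (fun a => integral_nonneg fun p => sq_nonneg _)
      (fun a i => InContext.hasDerivAt_update_smul hdiff S⁻¹ a i)
      -- The full squared gradient is `K` times that of g; `K + 1` also covers K = 0.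
      (show 0 < ε / (K + 1) by positivity)
    refine (hb ⟨A a, hA a, rfl⟩).trans ?_
    simp only [InContext.layerGradient_sparseLoss hS (hA a), norm_smul _ ((d : ℝ)⁻¹ • S.transpose),
      mul_pow, Real.norm_eq_abs, sq_abs]
    rw [← Finset.sum_mul, zero_add, ← hK]
    have hK0 : 0 ≤ K := sq_nonneg _
    calc _ ≤ ε / (K + 1) * K := mul_le_mul_of_nonneg_right ha hK0
      _ = ε * (K / (K + 1)) := by ring
      _ ≤ ε := mul_le_of_le_one_right hε.le ((div_le_one (by positivity)).2 (by linarith))
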